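/- Let $(\pi^n)_{n\ge 0}$, $\pi^n=(0=t^n_0<t^n_1<\cdots<t^n_{N(\pi^n)}=1)$, be a finitely refining sequence of partitions of $[0,1]$ starting from the trivial partition $\pi^0=(0,1)$: that is, $\pi^m\subseteq\pi^n$ for $m\le n$, the mesh $|\pi^n|=\max_j|t^n_{j+1}-t^n_j|$ tends to $0$, and there is $M<\infty$ such that for all $n$ and $k$ there are at most $M$ points of $\pi^{n+1}$ strictly between $t^n_k$ and $t^n_{k+1}$. Put $p(m,k)=\inf\{j\ge0: t^{m+1}_j\ge t^m_k\}$. For $m\ge 0$, $0\le k<N(\pi^m)$ and $2\le i\le p(m,k+1)-p(m,k)$ write $a=t^{m+1}_{p(m,k)}$, $b=t^{m+1}_{p(m,k)+i-1}$, $c=t^{m+1}_{p(m,k)+i}$, and let $$\psi_{m,k,i}=\Big(\tfrac{c-b}{b-a}\cdot\tfrac1{c-a}\Big)^{1/2}\mathbf 1_{[a,b)}-\Big(\tfrac{b-a}{c-b}\cdot\tfrac1{c-a}\Big)^{1/2}\mathbf 1_{[b,c)},\qquad e^\pi_{m,k,i}(t)=\int_0^t\psi_{m,k,i}(s)\,ds$$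 be the associated Haar and Schauder functions. Let $W=(W(t))_{t\in[0,1]}$ be a Brownian motion on a probability space $(\Omega,\mathcal F,\mathbb P)$, with arbitrary initial value $W(0)$: it has independent increments, $W(t)-W(s)\sim N(0,t-s)$ for $s\le t$, and almost surely continuous paths. Then there are random variables $\eta_{m,k,i}$ which are independent and identically distributed with law $N(0,1)$, such that almost surely $$W(t)=W(0)+(W(1)-W(0))\,t+\sum_{m=0}^{\infty}\ \sum_{k,i}\eta_{m,k,i}\,e^\pi_{m,k,i}(t)\qquad\text{for all }t\in[0,1],$$ where the inner sum is finite and the series over $m$ converges uniformly in $t\in[0,1]$. Moreover these are the Schauder coefficients of $W$: almost surely, $(\eta_{m,k,i})$ is the only family of real numbers for which this expansion of $W$ holds at every $t\in[0,1]$. -/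

import Mathlib

open MeasureTheory ProbabilityTheory Filter Topology

noncomputable section

/-- A finite partition `0 = t₀ < t₁ < ⋯ < t_N = 1` of `[0, 1]`, with `N` intervals.
Only the values `pt j` with `j ≤ N` matter. -/
structure UnitPartition where
  N : ℕ
  pt : ℕ → ℝ
  pt_zero : pt 0 = 0
  pt_last : pt N = 1
  strictMonoOn : StrictMonoOn pt (Set.Iic N)

namespace UnitPartition

/-- The set of partition points. -/
def points (π : UnitPartition) : Set ℝ := π.pt '' Set.Iic π.N

/-- The length of the largest interval of the partition. -/
def mesh (π : UnitPartition) : ℝ := ⨆ j : Fin π.N, |π.pt (j + 1) - π.pt j|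

end UnitPartition

/-- A finitely refining sequence of partitions: nested, with vanishing mesh, and such that the
number of points of `π (n + 1)` between two consecutive points of `π n` is bounded uniformly. -/
structure IsFinitelyRefining (π : ℕ → UnitPartition) : Prop where
  refining : ∀ m n, m ≤ n → (π m).points ⊆ (π n).points
  mesh_tendsto : Tendsto (fun n => (π n).mesh) atTop (𝓝 0)
  finite_branching : ∃ M : ℕ, ∀ n, ∀ k < (π n).N,
    ((π (n + 1)).points ∩ Set.Ioo ((π n).pt k) ((π n).pt (k + 1))).ncard ≤ M

namespace Schauder

/-- `p(m, k)`: the least index `j` with `t^{m+1}_j ≥ t^m_k`. -/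
def childIndex (π : ℕ → UnitPartition) (m k : ℕ) : ℕ :=
  sInf {j : ℕ | (π m).pt k ≤ (π (m + 1)).pt j}

/-- The two-step function on `[a, c)` with a jump at `b`, of zero mean and unit `L²` norm
when `a < b < c`. -/
def haarStep (a b c t : ℝ) : ℝ :=
  if t ∈ Set.Ico a b then Real.sqrt ((c - b) / (b - a) * (1 / (c - a)))
  else if t ∈ Set.Ico b c then -Real.sqrt ((b - a) / (c - b) * (1 / (c - a)))
  else 0

/-- The non-uniform Haar function `ψ_{m,k,i}`; its support is
`[t^{m+1}_{p(m,k)}, t^{m+1}_{p(m,k)+i}]` and it jumps inside at `t^{m+1}_{p(m,k)+i-1}`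
(here `i ≥ 2`, see `Index`). -/
def haar (π : ℕ → UnitPartition) (m k i : ℕ) : ℝ → ℝ :=
  haarStep ((π (m + 1)).pt (childIndex π m k))
    ((π (m + 1)).pt (childIndex π m k + (i - 1)))
    ((π (m + 1)).pt (childIndex π m k + i))

/-- The Schauder function `e_{m,k,i}(t) = ∫₀ᵗ ψ_{m,k,i}(s) ds`. -/
def schauderFun (π : ℕ → UnitPartition) (m k i : ℕ) (t : ℝ) : ℝ :=
  ∫ s in (0 : ℝ)..t, haar π m k i s

/-- The indices of level `m`: pairs `(k, i)` with `0 ≤ k < N(π^m)` and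
`2 ≤ i ≤ p(m,k+1) - p(m,k)`. There is one for each point of `π^{m+1}` not in `π^m`. -/
def levelIndices (π : ℕ → UnitPartition) (m : ℕ) : Finset (ℕ × ℕ) :=
  (Finset.range (π m).N).biUnion fun k =>
    (Finset.Icc 2 (childIndex π m (k + 1) - childIndex π m k)).image fun i => (k, i)

/-- The index set of the whole Schauder system: a level `m` and an index `(k, i)` of level `m`. -/
abbrev Index (π : ℕ → UnitPartition) : Type := Σ m : ℕ, {x : ℕ × ℕ // x ∈ levelIndices π m}

/-- The `n`-th partial sum
`x(0) + (x(1) - x(0)) t + ∑_{m < n} ∑_{(k,i)} θ_{m,k,i} e_{m,k,i}(t)`. -/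
def partialSum (π : ℕ → UnitPartition) (x : unitInterval → ℝ) (θ : Index π → ℝ) (n : ℕ)
    (t : unitInterval) : ℝ :=
  x 0 + (x 1 - x 0) * (t : ℝ) +
    ∑ m ∈ Finset.range n, ∑ j : {x : ℕ × ℕ // x ∈ levelIndices π m},
      θ ⟨m, j⟩ * schauderFun π m j.1.1 j.1.2 t

end Schauder

/-- Brownian motion on the time interval `[0, 1]`, with an arbitrary initial value: independent
increments, `W t - W s ∼ N(0, t - s)` for `s ≤ t`, and almost surely continuous paths.
(The standard Brownian motion is the case `W 0 = 0`.) -/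
structure IsBrownianMotionOnUnit {Ω : Type*} [MeasurableSpace Ω]
    (W : unitInterval → Ω → ℝ) (P : Measure Ω) : Prop where
  aemeasurable : ∀ t, AEMeasurable (W t) P
  indepIncrements : HasIndepIncrements W P
  law_increment : ∀ s t : unitInterval, s ≤ t →
    HasLaw (fun ω => W t ω - W s ω) (gaussianReal 0 ((t : ℝ) - (s : ℝ)).toNNReal) P
  continuous_paths : ∀ᵐ ω ∂P, Continuous fun t => W t ω

end

/-! Integrating a Haar function against `df` gives a functional, `haarCoeff`, that reads `f` only at
the two ends and the jump of that Haar function. On a path it yields the Schauder coefficient; on `s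
↦ min t s` it yields the Schauder function at `t`, here `hat`. Orthonormality of the Haar system
becomes biorthogonality (`haarCoeff_hat`): the `j`-th functional of the `j'`-th hat is 1 if `j = j'`
and 0 otherwise.

The expansion is deterministic. A function that vanishes at 0 and 1 and has zero coefficients below
level `n` vanishes on `π n` (`eq_zero_on_points`). Hence the `n`-th partial sum is the piecewise
linear interpolation of the path along `π n`, and uniform continuity with vanishing mesh gives
uniform convergence. Applying the functionals to any expansion recovers its coefficients
(`eq_schauderCoeff`).

Probability enters because `min s t` is also the covariance of `W - W 0`: by biorthogonality the
coefficients are uncorrelated with variance 1 (`covariance_schauderCoeff`). Being jointly Gaussian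
and centred, they are independent standard normals. -/

namespace Schauder

/-- The integral of `haarStep a b c` against the increments of `f`. -/
noncomputable def haarCoeff (a b c : ℝ) (f : ℝ → ℝ) : ℝ :=
  √((c - b) / (b - a) * (1 / (c - a))) * (f b - f a) -
    √((b - a) / (c - b) * (1 / (c - a))) * (f c - f b)

/-- The closed form on `[0, ∞)` of the primitive of `haarStep a b c`. -/
noncomputable def hat (a b c t : ℝ) : ℝ := haarCoeff a b c fun s => min t s

/-! ### A single Haar functional and its hat function -/

section Hat

variable {a b c : ℝ}

lemma sqrt_left_pos (hab : a < b) (hbc : b < c) :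
    0 < √((c - b) / (b - a) * (1 / (c - a))) := by
  have h1 := sub_pos.2 hab
  have h2 := sub_pos.2 hbc
  have h3 := sub_pos.2 (hab.trans hbc)
  positivity

lemma sqrt_left_mul (hab : a < b) (hbc : b < c) :
    √((c - b) / (b - a) * (1 / (c - a))) * (b - a) = √((c - b) * (b - a) / (c - a)) := by
  have h1 := sub_pos.2 hab
  have h2 := sub_pos.2 hbc
  have h3 := sub_pos.2 (hab.trans hbc)
  nth_rewrite 2 [← Real.sqrt_sq h1.le]
  rw [← Real.sqrt_mul (by positivity)]
  congr 1
  field_simp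

lemma sqrt_right_mul (hab : a < b) (hbc : b < c) :
    √((b - a) / (c - b) * (1 / (c - a))) * (c - b) = √((c - b) * (b - a) / (c - a)) := by
  have h1 := sub_pos.2 hab
  have h2 := sub_pos.2 hbc
  have h3 := sub_pos.2 (hab.trans hbc)
  nth_rewrite 2 [← Real.sqrt_sq h2.le]
  rw [← Real.sqrt_mul (by positivity)]
  congr 1
  field_simp

/-- This is the zero mean of the Haar step; it makes the functional kill affine functions and the
hat return to 0 at `c`. -/
lemma sqrt_left_mul_eq (hab : a < b) (hbc : b < c) :
    √((c - b) / (b - a) * (1 / (c - a))) * (b - a) =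
      √((b - a) / (c - b) * (1 / (c - a))) * (c - b) := by
  rw [sqrt_left_mul hab hbc, sqrt_right_mul hab hbc]

lemma haarCoeff_congr {f g : ℝ → ℝ} (ha : f a = g a) (hb : f b = g b) (hc : f c = g c) :
    haarCoeff a b c f = haarCoeff a b c g := by
  simp [haarCoeff, ha, hb, hc]

lemma haarCoeff_affine (hab : a < b) (hbc : b < c) {f : ℝ → ℝ} (α β : ℝ)
    (h : ∀ t ∈ Set.Icc a c, f t = α + β * t) : haarCoeff a b c f = 0 := by
  rw [haarCoeff, h a ⟨le_rfl, (hab.trans hbc).le⟩, h b ⟨hab.le, hbc.le⟩,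
    h c ⟨(hab.trans hbc).le, le_rfl⟩]
  linear_combination β * sqrt_left_mul_eq hab hbc

lemma haarCoeff_add (f g : ℝ → ℝ) :
    haarCoeff a b c (fun t => f t + g t) = haarCoeff a b c f + haarCoeff a b c g := by
  simp only [haarCoeff]; ring

lemma haarCoeff_sub (f g : ℝ → ℝ) :
    haarCoeff a b c (fun t => f t - g t) = haarCoeff a b c f - haarCoeff a b c g := by
  simp only [haarCoeff]; ring

lemma haarCoeff_const_mul (r : ℝ) (f : ℝ → ℝ) :
    haarCoeff a b c (fun t => r * f t) = r * haarCoeff a b c f := by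
  simp only [haarCoeff]; ring

lemma haarCoeff_sum {ι : Type*} (s : Finset ι) (f : ι → ℝ → ℝ) :
    haarCoeff a b c (fun t => ∑ i ∈ s, f i t) = ∑ i ∈ s, haarCoeff a b c (f i) := by
  simp only [haarCoeff, ← Finset.sum_sub_distrib, Finset.mul_sum]

lemma tendsto_haarCoeff {u : ℕ → ℝ → ℝ} {f : ℝ → ℝ}
    (ha : Tendsto (fun n => u n a) atTop (𝓝 (f a)))
    (hb : Tendsto (fun n => u n b) atTop (𝓝 (f b)))
    (hc : Tendsto (fun n => u n c) atTop (𝓝 (f c))) :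
    Tendsto (fun n => haarCoeff a b c (u n)) atTop (𝓝 (haarCoeff a b c f)) :=
  ((hb.sub ha).const_mul _).sub ((hc.sub hb).const_mul _)

/-- A function vanishing at the endpoints and with zero coefficient vanishes at the jump. -/
lemma eq_zero_of_haarCoeff_eq_zero (hab : a < b) (hbc : b < c) {f : ℝ → ℝ}
    (ha : f a = 0) (hc : f c = 0) (h : haarCoeff a b c f = 0) : f b = 0 := by
  have h1 := sqrt_left_pos hab hbc
  have h2 : (√((c - b) / (b - a) * (1 / (c - a))) +
      √((b - a) / (c - b) * (1 / (c - a)))) * f b = 0 := by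
    rw [haarCoeff, ha, hc] at h
    linear_combination h
  exact (mul_eq_zero.1 h2).resolve_left (by positivity)

lemma hat_of_le_left (hab : a < b) (hbc : b < c) {t : ℝ} (h : t ≤ a) : hat a b c t = 0 := by
  simp [hat, haarCoeff, min_eq_left h, min_eq_left (h.trans hab.le),
    min_eq_left (h.trans (hab.trans hbc).le)]

lemma hat_of_right_le (hab : a < b) (hbc : b < c) {t : ℝ} (h : c ≤ t) : hat a b c t = 0 := by
  rw [hat, haarCoeff, min_eq_right h, min_eq_right (hbc.le.trans h),
    min_eq_right ((hab.trans hbc).le.trans h), sqrt_left_mul_eq hab hbc, sub_self]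

lemma hat_of_mem_left (hbc : b < c) {t : ℝ} (h : t ∈ Set.Icc a b) :
    hat a b c t = √((c - b) / (b - a) * (1 / (c - a))) * (t - a) := by
  simp [hat, haarCoeff, min_eq_left h.2, min_eq_right h.1, min_eq_left (h.2.trans hbc.le)]

lemma hat_of_mem_right (hab : a < b) (hbc : b < c) {t : ℝ} (h : t ∈ Set.Icc b c) :
    hat a b c t = √((b - a) / (c - b) * (1 / (c - a))) * (c - t) := by
  rw [hat, haarCoeff, min_eq_right h.1, min_eq_left h.2, min_eq_right (hab.le.trans h.1)]
  linear_combination sqrt_left_mul_eq hab hbc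

/-- The only kinks of a hat are at `a`, `b` and `c`. -/
lemma exists_affine_hat (hab : a < b) (hbc : b < c) {u v : ℝ}
    (ha : a ∉ Set.Ioo u v) (hb : b ∉ Set.Ioo u v) (hc : c ∉ Set.Ioo u v) :
    ∃ α β : ℝ, ∀ t ∈ Set.Icc u v, hat a b c t = α + β * t := by
  simp only [Set.mem_Ioo, not_and, not_lt] at ha hb hc
  rcases lt_or_ge u a with h | h
  · exact ⟨0, 0, fun t ht => by rw [hat_of_le_left hab hbc (ht.2.trans (ha h))]; ring⟩
  rcases lt_or_ge u b with h' | h'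
  · refine ⟨-√((c - b) / (b - a) * (1 / (c - a))) * a, √((c - b) / (b - a) * (1 / (c - a))),
      fun t ht => ?_⟩
    rw [hat_of_mem_left hbc ⟨h.trans ht.1, ht.2.trans (hb h')⟩]
    ring
  rcases lt_or_ge u c with h'' | h''
  · refine ⟨√((b - a) / (c - b) * (1 / (c - a))) * c, -√((b - a) / (c - b) * (1 / (c - a))),
      fun t ht => ?_⟩
    rw [hat_of_mem_right hab hbc ⟨h'.trans ht.1, ht.2.trans (hc h'')⟩]
    ring
  · exact ⟨0, 0, fun t ht => by rw [hat_of_right_le hab hbc (h''.trans ht.1)]; ring⟩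

lemma haarCoeff_hat_self (hab : a < b) (hbc : b < c) : haarCoeff a b c (hat a b c) = 1 := by
  have h1 := sub_pos.2 hab
  have h2 := sub_pos.2 hbc
  have h3 := sub_pos.2 (hab.trans hbc)
  have hl := Real.sq_sqrt (x := (c - b) / (b - a) * (1 / (c - a))) (by positivity)
  have hr := Real.sq_sqrt (x := (b - a) / (c - b) * (1 / (c - a))) (by positivity)
  have e := sqrt_left_mul_eq hab hbc
  rw [haarCoeff, hat_of_le_left hab hbc le_rfl, hat_of_right_le hab hbc le_rfl,
    hat_of_mem_left hbc ⟨hab.le, le_rfl⟩]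
  set l := √((c - b) / (b - a) * (1 / (c - a)))
  set r := √((b - a) / (c - b) * (1 / (c - a)))
  -- The right side is the squared L² norm of the Haar step.
  have : l * (l * (b - a) - 0) - r * (0 - l * (b - a)) = l ^ 2 * (b - a) + r ^ 2 * (c - b) := by
    linear_combination r * e
  rw [this, hl, hr]
  field_simp
  ring

lemma integral_indicator_Ico {t : ℝ} (ha : 0 ≤ a) (hab : a ≤ b) (ht : 0 ≤ t) :
    ∫ s in (0 : ℝ)..t, (Set.Ico a b).indicator (fun _ => (1 : ℝ)) s = min t b - min t a := by
  rw [intervalIntegral.integral_of_le ht, ← integral_Ico_eq_integral_Ioc,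
    setIntegral_indicator measurableSet_Ico, Set.Ico_inter_Ico, setIntegral_const,
    Real.volume_real_Ico, smul_eq_mul, mul_one, sup_eq_right.2 ha]
  rcases le_total t a with h | h
  · simp [h, h.trans hab]
  · rw [min_eq_right h, max_eq_left]
    simp [h, hab]

lemma haarStep_eq (a b c t : ℝ) :
    haarStep a b c t =
      √((c - b) / (b - a) * (1 / (c - a))) * (Set.Ico a b).indicator (fun _ => (1 : ℝ)) t -
      √((b - a) / (c - b) * (1 / (c - a))) * (Set.Ico b c).indicator (fun _ => (1 : ℝ)) t := by
  by_cases h1 : t ∈ Set.Ico a b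
  · have h2 : t ∉ Set.Ico b c := fun h => (h1.2.trans_le h.1).false
    rw [haarStep, if_pos h1, Set.indicator_of_mem h1, Set.indicator_of_notMem h2]
    ring
  · by_cases h2 : t ∈ Set.Ico b c
    · rw [haarStep, if_neg h1, if_pos h2, Set.indicator_of_notMem h1, Set.indicator_of_mem h2]
      ring
    · rw [haarStep, if_neg h1, if_neg h2, Set.indicator_of_notMem h1, Set.indicator_of_notMem h2]
      ring

/-- The length of `[a, b) ∩ [0, t]` is `min t b - min t a`, so integrating the step amounts to
applying the functional to `min t`. -/
lemma integral_haarStep {t : ℝ} (ha : 0 ≤ a) (hab : a < b) (hbc : b < c) (ht : 0 ≤ t) :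
    ∫ s in (0 : ℝ)..t, haarStep a b c s = hat a b c t := by
  have hi : ∀ u v : ℝ, IntervalIntegrable ((Set.Ico u v).indicator fun _ => (1 : ℝ))
      volume 0 t := fun u v =>
    (intervalIntegrable_iff_integrableOn_Ioc_of_le ht).2
      ((integrableOn_const (by simp)).indicator measurableSet_Ico)
  simp only [haarStep_eq]
  rw [intervalIntegral.integral_sub ((hi a b).const_mul _) ((hi b c).const_mul _),
    intervalIntegral.integral_const_mul, intervalIntegral.integral_const_mul,
    integral_indicator_Ico ha hab.le ht, integral_indicator_Ico (ha.trans hab.le) hbc.le ht]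
  rfl

end Hat

end Schauder

/-! ### Points and cells of a partition -/

namespace UnitPartition

variable (π : UnitPartition)

lemma N_pos : 0 < π.N := by
  rcases Nat.eq_zero_or_pos π.N with h | h
  · have := π.pt_last
    rw [h, π.pt_zero] at this
    norm_num at this
  · exact h

variable {π}

lemma pt_lt_pt {i j : ℕ} (h : i < j) (hj : j ≤ π.N) : π.pt i < π.pt j :=
  π.strictMonoOn (Set.mem_Iic.2 (h.le.trans hj)) hj h

lemma pt_le_pt {i j : ℕ} (h : i ≤ j) (hj : j ≤ π.N) : π.pt i ≤ π.pt j :=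
  π.strictMonoOn.monotoneOn (Set.mem_Iic.2 (h.trans hj)) hj h

lemma pt_mem_points {i : ℕ} (hi : i ≤ π.N) : π.pt i ∈ π.points := ⟨i, hi, rfl⟩

lemma pt_mem_Icc {i : ℕ} (hi : i ≤ π.N) : π.pt i ∈ Set.Icc (0 : ℝ) 1 :=
  ⟨π.pt_zero ▸ pt_le_pt (Nat.zero_le i) hi, π.pt_last ▸ pt_le_pt hi le_rfl⟩

lemma points_subset : π.points ⊆ Set.Icc (0 : ℝ) 1 := by
  rintro _ ⟨i, hi, rfl⟩
  exact pt_mem_Icc hi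

/-- No partition point lies strictly between two consecutive ones. -/
lemma le_or_le_of_mem_points {x : ℝ} (hx : x ∈ π.points) {k : ℕ} (hk : k < π.N) :
    x ≤ π.pt k ∨ π.pt (k + 1) ≤ x := by
  obtain ⟨i, hi, rfl⟩ := hx
  rcases Nat.lt_or_ge k i with h | h
  · exact .inr (pt_le_pt h hi)
  · exact .inl (pt_le_pt h hk.le)

lemma exists_mem_Icc {t : ℝ} (ht : t ∈ Set.Icc (0 : ℝ) 1) :
    ∃ k < π.N, t ∈ Set.Icc (π.pt k) (π.pt (k + 1)) := by
  classical
  have hex : ∃ k, t ≤ π.pt (k + 1) :=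
    ⟨π.N - 1, by rw [Nat.sub_add_cancel π.N_pos, π.pt_last]; exact ht.2⟩
  have hlt : Nat.find hex < π.N := by
    have := Nat.find_min' hex (m := π.N - 1)
      (by rw [Nat.sub_add_cancel π.N_pos, π.pt_last]; exact ht.2)
    have := π.N_pos
    omega
  refine ⟨Nat.find hex, hlt, ?_, Nat.find_spec hex⟩
  rcases h : Nat.find hex with _ | k
  · rw [π.pt_zero]; exact ht.1
  · exact (not_le.1 (Nat.find_min hex (m := k) (by omega))).le

lemma sub_le_mesh {k : ℕ} (hk : k < π.N) : π.pt (k + 1) - π.pt k ≤ π.mesh :=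
  (le_abs_self _).trans (le_ciSup (f := fun j : Fin π.N => |π.pt (j + 1) - π.pt j|)
    (Set.finite_range _).bddAbove ⟨k, hk⟩)

end UnitPartition

/-! ### Biorthogonality and completeness of the Schauder system -/

namespace Schauder

open UnitPartition

variable {π : ℕ → UnitPartition}

/-- Nestedness puts `(π m).pt k` among the points of `π (m + 1)`, so the infimum is attained with
equality. -/
lemma childIndex_spec (hπ : IsFinitelyRefining π) {m k : ℕ} (hk : k ≤ (π m).N) :
    childIndex π m k ≤ (π (m + 1)).N ∧ (π (m + 1)).pt (childIndex π m k) = (π m).pt k := by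
  obtain ⟨j, hj, hjk⟩ := hπ.refining m (m + 1) m.le_succ (pt_mem_points hk)
  have hj' : j ∈ {j : ℕ | (π m).pt k ≤ (π (m + 1)).pt j} := hjk.ge
  have hle : childIndex π m k ≤ j := Nat.sInf_le hj'
  exact ⟨hle.trans hj, le_antisymm (hjk ▸ pt_le_pt hle hj) (Nat.sInf_mem ⟨j, hj'⟩)⟩

/-- The left end of the support of a Haar function. -/
noncomputable def leftPt (π : ℕ → UnitPartition) (j : Index π) : ℝ :=
  (π (j.1 + 1)).pt (childIndex π j.1 j.2.1.1)

/-- The point where a Haar function jumps inside its support. -/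
noncomputable def midPt (π : ℕ → UnitPartition) (j : Index π) : ℝ :=
  (π (j.1 + 1)).pt (childIndex π j.1 j.2.1.1 + (j.2.1.2 - 1))

/-- The right end of the support of a Haar function. -/
noncomputable def rightPt (π : ℕ → UnitPartition) (j : Index π) : ℝ :=
  (π (j.1 + 1)).pt (childIndex π j.1 j.2.1.1 + j.2.1.2)

lemma mem_levelIndices {m : ℕ} {x : ℕ × ℕ} :
    x ∈ levelIndices π m ↔ x.1 < (π m).N ∧ 2 ≤ x.2 ∧
      x.2 ≤ childIndex π m (x.1 + 1) - childIndex π m x.1 := by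
  obtain ⟨k, i⟩ := x
  simp only [levelIndices, Finset.mem_biUnion, Finset.mem_range, Finset.mem_image,
    Finset.mem_Icc, Prod.mk.injEq]
  constructor
  · rintro ⟨k', hk, i', hi, rfl, rfl⟩
    exact ⟨hk, hi⟩
  · rintro ⟨hk, hi⟩
    exact ⟨k, hk, i, hi, rfl, rfl⟩

lemma add_le_childIndex_succ (j : Index π) :
    childIndex π j.1 j.2.1.1 + j.2.1.2 ≤ childIndex π j.1 (j.2.1.1 + 1) := by
  have := mem_levelIndices.1 j.2.2
  omega

lemma add_le_N (hπ : IsFinitelyRefining π) (j : Index π) :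
    childIndex π j.1 j.2.1.1 + j.2.1.2 ≤ (π (j.1 + 1)).N :=
  (add_le_childIndex_succ j).trans
    (childIndex_spec hπ (Nat.succ_le_of_lt (mem_levelIndices.1 j.2.2).1)).1

lemma leftPt_lt_midPt (hπ : IsFinitelyRefining π) (j : Index π) : leftPt π j < midPt π j := by
  have := mem_levelIndices.1 j.2.2
  have := add_le_N hπ j
  exact pt_lt_pt (by omega) (by omega)

lemma midPt_lt_rightPt (hπ : IsFinitelyRefining π) (j : Index π) : midPt π j < rightPt π j := by
  have := mem_levelIndices.1 j.2.2
  have := add_le_N hπ j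
  exact pt_lt_pt (by omega) (by omega)

lemma leftPt_mem (hπ : IsFinitelyRefining π) (j : Index π) : leftPt π j ∈ (π (j.1 + 1)).points :=
  pt_mem_points (by have := add_le_N hπ j; omega)

lemma midPt_mem (hπ : IsFinitelyRefining π) (j : Index π) : midPt π j ∈ (π (j.1 + 1)).points :=
  pt_mem_points (by have := add_le_N hπ j; omega)

lemma rightPt_mem (hπ : IsFinitelyRefining π) (j : Index π) : rightPt π j ∈ (π (j.1 + 1)).points :=
  pt_mem_points (add_le_N hπ j)

lemma leftPt_eq (hπ : IsFinitelyRefining π) (j : Index π) : leftPt π j = (π j.1).pt j.2.1.1 :=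
  (childIndex_spec hπ (mem_levelIndices.1 j.2.2).1.le).2

lemma rightPt_le (hπ : IsFinitelyRefining π) (j : Index π) :
    rightPt π j ≤ (π j.1).pt (j.2.1.1 + 1) := by
  have h := childIndex_spec hπ (Nat.succ_le_of_lt (mem_levelIndices.1 j.2.2).1)
  rw [← h.2]
  exact pt_le_pt (add_le_childIndex_succ j) h.1

lemma schauderFun_eq_hat (hπ : IsFinitelyRefining π) (j : Index π) {t : ℝ} (ht : 0 ≤ t) :
    schauderFun π j.1 j.2.1.1 j.2.1.2 t = hat (leftPt π j) (midPt π j) (rightPt π j) t :=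
  integral_haarStep (points_subset (leftPt_mem hπ j)).1 (leftPt_lt_midPt hπ j)
    (midPt_lt_rightPt hπ j) ht

/-- A Schauder function of level `m` vanishes on the partition `π m`. -/
lemma hat_eq_zero_of_mem_points (hπ : IsFinitelyRefining π) (j : Index π) {t : ℝ}
    (ht : t ∈ (π j.1).points) :
    hat (leftPt π j) (midPt π j) (rightPt π j) t = 0 := by
  rcases le_or_le_of_mem_points ht (mem_levelIndices.1 j.2.2).1 with h | h
  · exact hat_of_le_left (leftPt_lt_midPt hπ j) (midPt_lt_rightPt hπ j)
      (h.trans (leftPt_eq hπ j).ge)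
  · exact hat_of_right_le (leftPt_lt_midPt hπ j) (midPt_lt_rightPt hπ j)
      ((rightPt_le hπ j).trans h)

/-- A Schauder function of level below `n` is affine between consecutive points of `π n`. -/
lemma exists_affine_hat_of_lt (hπ : IsFinitelyRefining π) (j : Index π) {n k : ℕ}
    (hn : j.1 < n) (hk : k < (π n).N) :
    ∃ α β : ℝ, ∀ t ∈ Set.Icc ((π n).pt k) ((π n).pt (k + 1)),
      hat (leftPt π j) (midPt π j) (rightPt π j) t = α + β * t := by
  have key : ∀ x ∈ (π (j.1 + 1)).points, x ∉ Set.Ioo ((π n).pt k) ((π n).pt (k + 1)) := by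
    intro x hx h
    rcases le_or_le_of_mem_points (hπ.refining _ n hn hx) hk with h' | h'
    · exact (h.1.trans_le h').false
    · exact (h.2.trans_le h').false
  exact exists_affine_hat (leftPt_lt_midPt hπ j) (midPt_lt_rightPt hπ j)
    (key _ (leftPt_mem hπ j)) (key _ (midPt_mem hπ j)) (key _ (rightPt_mem hπ j))

/-- Orthonormality of the Haar system, expressed by Haar functionals of Schauder functions. -/
lemma haarCoeff_hat (hπ : IsFinitelyRefining π) (j j' : Index π) :
    haarCoeff (leftPt π j) (midPt π j) (rightPt π j)
      (hat (leftPt π j') (midPt π j') (rightPt π j')) = if j = j' then 1 else 0 := by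
  have hab := leftPt_lt_midPt hπ j
  have hbc := midPt_lt_rightPt hπ j
  have hab' := leftPt_lt_midPt hπ j'
  have hbc' := midPt_lt_rightPt hπ j'
  split_ifs with hj
  · subst hj
    exact haarCoeff_hat_self hab hbc
  have vanish (ha : hat (leftPt π j') (midPt π j') (rightPt π j') (leftPt π j) = 0)
      (hb : hat (leftPt π j') (midPt π j') (rightPt π j') (midPt π j) = 0)
      (hc : hat (leftPt π j') (midPt π j') (rightPt π j') (rightPt π j) = 0) :
     haarCoeff (leftPt π j) (midPt π j) (rightPt π j)
        (hat (leftPt π j') (midPt π j') (rightPt π j')) = 0 := by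
    simp [haarCoeff, ha, hb, hc]
  have hk := (mem_levelIndices.1 j.2.2).1
  have hk' := (mem_levelIndices.1 j'.2.2).1
  rcases lt_trichotomy j.1 j'.1 with h | h | h
  · have key : ∀ x ∈ (π (j.1 + 1)).points,
        hat (leftPt π j') (midPt π j') (rightPt π j') x = 0 := fun x hx =>
      hat_eq_zero_of_mem_points hπ j' (hπ.refining _ _ h hx)
    exact vanish (key _ (leftPt_mem hπ j)) (key _ (midPt_mem hπ j)) (key _ (rightPt_mem hπ j))
  · rcases lt_trichotomy j.2.1.1 j'.2.1.1 with h1 | h1 | h1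
    · have hle : rightPt π j ≤ leftPt π j' := by
        refine (rightPt_le hπ j).trans ?_
        rw [leftPt_eq hπ j', congrArg π h]
        exact pt_le_pt h1 hk'.le
      exact vanish (hat_of_le_left hab' hbc' (hab.trans hbc |>.le.trans hle))
        (hat_of_le_left hab' hbc' (hbc.le.trans hle)) (hat_of_le_left hab' hbc' hle)
    -- Same parent cell: both supports start at the same point, so the one with smaller `i` ends no
    -- later than the jump of the other.
    · have hp : leftPt π j' = leftPt π j := by simp only [leftPt, h, h1]
      have hN := add_le_N hπ j
      have hN' := add_le_N hπ j'
      have hi := (mem_levelIndices.1 j.2.2).2.1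
      have hi' := (mem_levelIndices.1 j'.2.2).2.1
      rcases lt_trichotomy j.2.1.2 j'.2.1.2 with h2 | h2 | h2
      · have hle : rightPt π j ≤ midPt π j' := by
          simp only [rightPt, midPt, h, h1]
          exact pt_le_pt (by omega) (by omega)
        obtain ⟨α, β, hαβ⟩ := exists_affine_hat (u := leftPt π j) (v := rightPt π j) hab' hbc'
          (fun hx => (hx.1.trans_eq hp).false) (fun hx => (hx.2.trans_le hle).false)
          (fun hx => (hx.2.trans_le (hle.trans hbc'.le)).false)
        exact haarCoeff_affine hab hbc α β hαβ
      · refine absurd ?_ hj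
        obtain ⟨m, ⟨k, i⟩, hx⟩ := j
        obtain ⟨m', ⟨k', i'⟩, hx'⟩ := j'
        obtain rfl : m = m' := h
        obtain rfl : k = k' := h1
        obtain rfl : i = i' := h2
        rfl
      · have hle : rightPt π j' ≤ midPt π j := by
          simp only [rightPt, midPt, ← h, ← h1]
          exact pt_le_pt (by omega) (by omega)
        exact vanish (hat_of_le_left hab' hbc' hp.ge) (hat_of_right_le hab' hbc' hle)
          (hat_of_right_le hab' hbc' (hle.trans hbc.le))
    · have hle : rightPt π j' ≤ leftPt π j := by
        refine (rightPt_le hπ j').trans ?_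
        rw [leftPt_eq hπ j, ← congrArg π h]
        exact pt_le_pt h1 hk.le
      exact vanish (hat_of_right_le hab' hbc' hle) (hat_of_right_le hab' hbc' (hle.trans hab.le))
        (hat_of_right_le hab' hbc' (hle.trans (hab.trans hbc).le))
  -- The coarser hat is affine on the whole parent cell of `j`.
  · obtain ⟨α, β, hαβ⟩ := exists_affine_hat_of_lt hπ j' h hk
    exact haarCoeff_affine hab hbc α β fun t ht =>
      hαβ t ⟨(leftPt_eq hπ j).ge.trans ht.1, ht.2.trans (rightPt_le hπ j)⟩

/-- A function vanishing on the trivial partition, with zero coefficients at all levels below `n`,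
vanishes on `π n`. -/
lemma eq_zero_on_points (hπ : IsFinitelyRefining π) {f : ℝ → ℝ} (n : ℕ)
    (h0 : ∀ t ∈ (π 0).points, f t = 0)
    (hf : ∀ j : Index π, j.1 < n → haarCoeff (leftPt π j) (midPt π j) (rightPt π j) f = 0) :
    ∀ t ∈ (π n).points, f t = 0 := by
  induction n with
  | zero => exact h0
  | succ m ih =>
    specialize ih fun j hj => hf j (hj.trans m.lt_succ_self)
    intro t ht
    obtain ⟨k, hk, hkt⟩ := (π m).exists_mem_Icc (points_subset ht)
    obtain ⟨hpN, hp⟩ := childIndex_spec hπ hk.le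
    obtain ⟨hqN, hq⟩ := childIndex_spec hπ (Nat.succ_le_of_lt hk)
    obtain ⟨l, hl, rfl⟩ := ht
    have hl' : l ≤ (π (m + 1)).N := hl
    have hmono := (π (m + 1)).strictMonoOn
    have hpl : childIndex π m k ≤ l := (hmono.le_iff_le hpN hl).1 (hp.le.trans hkt.1)
    have hlq : l ≤ childIndex π m (k + 1) := (hmono.le_iff_le hl hqN).1 (hkt.2.trans hq.ge)
    obtain ⟨i, rfl⟩ := Nat.exists_eq_add_of_le hpl
    obtain ⟨r, hr⟩ := Nat.exists_eq_add_of_le (hpl.trans hlq)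
    have hfp : f ((π (m + 1)).pt (childIndex π m k)) = 0 := by
      rw [hp]; exact ih _ (pt_mem_points hk.le)
    have hfq : f ((π (m + 1)).pt (childIndex π m k + r)) = 0 := by
      rw [← hr, hq]; exact ih _ (pt_mem_points hk)
    have hir : i ≤ r := by omega
    clear hkt hl hl' hpl hlq
    -- Zeros spread leftwards from the right end of the cell: the Haar function with second index `i
    -- + 1` starts at the left end of the cell, jumps at the `i`-th point and ends at the next one,
    -- already known to be a zero.
    induction hir using Nat.decreasingInduction with
    | self => exact hfq
    | of_succ i hi hfi =>
      rcases Nat.eq_zero_or_pos i with rfl | hpos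
      · exact hfp
      let j : Index π := ⟨m, (k, i + 1), mem_levelIndices.2 ⟨hk, by simp; omega, by simp; omega⟩⟩
      exact eq_zero_of_haarCoeff_eq_zero (leftPt_lt_midPt hπ j) (midPt_lt_rightPt hπ j) hfp hfi
        (hf j m.lt_succ_self)

end Schauder

/-! ### Expansion of a continuous path and its uniqueness -/

namespace Schauder

open UnitPartition

variable {π : ℕ → UnitPartition}

/-- The Schauder coefficient of index `j` of a function on the unit interval. -/
noncomputable def schauderCoeff (π : ℕ → UnitPartition) (x : unitInterval → ℝ) (j : Index π) : ℝ :=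
  haarCoeff (leftPt π j) (midPt π j) (rightPt π j) (Set.IccExtend zero_le_one x)

/-- The partial sums of the Schauder series, as functions on the real line. -/
noncomputable def hatSum (π : ℕ → UnitPartition) (x : unitInterval → ℝ) (θ : Index π → ℝ) (n : ℕ)
    (t : ℝ) : ℝ :=
  x 0 + (x 1 - x 0) * t + ∑ m ∈ Finset.range n, ∑ j : {x : ℕ × ℕ // x ∈ levelIndices π m},
    θ ⟨m, j⟩ * hat (leftPt π ⟨m, j⟩) (midPt π ⟨m, j⟩) (rightPt π ⟨m, j⟩) t

lemma partialSum_eq_hatSum (hπ : IsFinitelyRefining π) (x : unitInterval → ℝ) (θ : Index π → ℝ)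
    (n : ℕ) (t : unitInterval) : partialSum π x θ n t = hatSum π x θ n t := by
  simp only [partialSum, hatSum]
  congr 1
  refine Finset.sum_congr rfl fun m _ => Finset.sum_congr rfl fun j _ => ?_
  rw [← schauderFun_eq_hat hπ ⟨m, j⟩ t.2.1]

lemma haarCoeff_hatSum (hπ : IsFinitelyRefining π) (x : unitInterval → ℝ) (θ : Index π → ℝ)
    {n : ℕ} (j : Index π) (hj : j.1 < n) :
    haarCoeff (leftPt π j) (midPt π j) (rightPt π j) (hatSum π x θ n) = θ j := by
  unfold hatSum
  rw [haarCoeff_add, haarCoeff_affine (leftPt_lt_midPt hπ j) (midPt_lt_rightPt hπ j) (x 0)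
    (x 1 - x 0) fun _ _ => rfl, haarCoeff_sum, zero_add,
    Finset.sum_eq_single_of_mem j.1 (Finset.mem_range.2 hj), haarCoeff_sum,
    Finset.sum_eq_single_of_mem j.2 (Finset.mem_univ _)]
  · rw [haarCoeff_const_mul, haarCoeff_hat hπ j ⟨j.1, j.2⟩, if_pos rfl, mul_one]
  · intro i _ hi
    rw [haarCoeff_const_mul, haarCoeff_hat hπ j ⟨j.1, i⟩, if_neg, mul_zero]
    rintro h
    exact hi (eq_of_heq (Sigma.mk.inj h).2).symm
  · intro m _ hm
    rw [haarCoeff_sum]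
    refine Finset.sum_eq_zero fun i _ => ?_
    rw [haarCoeff_const_mul, haarCoeff_hat hπ j ⟨m, i⟩, if_neg, mul_zero]
    exact fun h => hm (congrArg Sigma.fst h).symm

/-- The partial sums interpolate the function at the points of the partitions. -/
lemma hatSum_eq_on_points (hπ : IsFinitelyRefining π) (hπ0 : (π 0).points = {0, 1})
    (x : unitInterval → ℝ) (n : ℕ) {t : ℝ} (ht : t ∈ (π n).points) :
    hatSum π x (schauderCoeff π x) n t = Set.IccExtend zero_le_one x t := by
  have hend : ∀ t ∈ (π 0).points, hatSum π x (schauderCoeff π x) n t =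
      x 0 + (x 1 - x 0) * t := by
    intro t ht
    rw [hatSum, add_eq_left]
    refine Finset.sum_eq_zero fun m _ => Finset.sum_eq_zero fun j _ => ?_
    rw [hat_eq_zero_of_mem_points hπ ⟨m, j⟩ (hπ.refining 0 m (Nat.zero_le m) ht), mul_zero]
  refine sub_eq_zero.1 (eq_zero_on_points hπ
    (f := fun t => hatSum π x (schauderCoeff π x) n t - Set.IccExtend zero_le_one x t)
    n (fun t ht => ?_) (fun j hj => ?_) t ht)
  · rw [hend t ht]
    rw [hπ0] at ht
    rcases ht with rfl | rfl
    · simp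
    · simp
  · rw [haarCoeff_sub, haarCoeff_hatSum hπ x _ j hj]
    exact sub_self _

lemma exists_affine_hatSum (hπ : IsFinitelyRefining π) (x : unitInterval → ℝ) (θ : Index π → ℝ)
    {n k : ℕ} (hk : k < (π n).N) :
    ∃ α β : ℝ, ∀ t ∈ Set.Icc ((π n).pt k) ((π n).pt (k + 1)), hatSum π x θ n t = α + β * t := by
  -- Placing `m < n` under the existential lets `choose` return coefficients defined for every
  -- level.
  have h : ∀ m (j : {x : ℕ × ℕ // x ∈ levelIndices π m}), ∃ α β : ℝ, m < n →
      ∀ t ∈ Set.Icc ((π n).pt k) ((π n).pt (k + 1)),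
        hat (leftPt π ⟨m, j⟩) (midPt π ⟨m, j⟩) (rightPt π ⟨m, j⟩) t = α + β * t := by
    intro m j
    by_cases hm : m < n
    · obtain ⟨α, β, h⟩ := exists_affine_hat_of_lt hπ ⟨m, j⟩ hm hk
      exact ⟨α, β, fun _ => h⟩
    · exact ⟨0, 0, fun h => absurd h hm⟩
  choose α β h using h
  refine ⟨x 0 + ∑ m ∈ Finset.range n, ∑ j, θ ⟨m, j⟩ * α m j,
    (x 1 - x 0) + ∑ m ∈ Finset.range n, ∑ j, θ ⟨m, j⟩ * β m j, fun t ht => ?_⟩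
  rw [add_mul, Finset.sum_mul, add_add_add_comm, ← Finset.sum_add_distrib]
  unfold hatSum
  congr 1
  refine Finset.sum_congr rfl fun m hm => ?_
  rw [Finset.sum_mul, ← Finset.sum_add_distrib]
  refine Finset.sum_congr rfl fun j _ => ?_
  rw [h m j (Finset.mem_range.1 hm) t ht]
  ring

lemma abs_sub_lt_of_affine {α β u v t y ε : ℝ} (ht : t ∈ Set.Icc u v)
    (hu : |α + β * u - y| < ε) (hv : |α + β * v - y| < ε) : |α + β * t - y| < ε := by
  rw [abs_lt] at *
  rcases le_total 0 β with h | h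
  · have h1 := mul_le_mul_of_nonneg_left ht.1 h
    have h2 := mul_le_mul_of_nonneg_left ht.2 h
    constructor <;> linarith
  · have h1 := mul_le_mul_of_nonpos_left ht.1 h
    have h2 := mul_le_mul_of_nonpos_left ht.2 h
    constructor <;> linarith

/-- The Schauder series of a continuous function converges to it uniformly. -/
lemma tendstoUniformly_partialSum (hπ : IsFinitelyRefining π) (hπ0 : (π 0).points = {0, 1})
    {x : unitInterval → ℝ} (hx : Continuous x) :
    TendstoUniformly (partialSum π x (schauderCoeff π x)) x atTop := by
  rw [Metric.tendstoUniformly_iff]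
  intro ε hε
  obtain ⟨δ, hδ, hxδ⟩ := Metric.uniformContinuous_iff.1
    (CompactSpace.uniformContinuous_of_continuous hx) ε hε
  filter_upwards [hπ.mesh_tendsto.eventually_lt_const hδ] with n hn t
  obtain ⟨k, hk, hkt⟩ := (π n).exists_mem_Icc t.2
  have hlen := (sub_le_mesh hk).trans_lt hn
  obtain ⟨α, β, h⟩ := exists_affine_hatSum hπ x (schauderCoeff π x) hk
  -- At the ends of the cell containing `t` the partial sum equals `x`, hence is within `ε` of `x
  -- t`; affinity carries the bound to `t`.
  have key : ∀ s ∈ Set.Icc ((π n).pt k) ((π n).pt (k + 1)), s ∈ (π n).points →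
      |α + β * s - x t| < ε := by
    intro s hs hsp
    rw [← h s hs, hatSum_eq_on_points hπ hπ0 x n hsp,
      Set.IccExtend_of_mem zero_le_one x (points_subset hsp)]
    refine hxδ (a := ⟨s, points_subset hsp⟩) ?_
    rw [Subtype.dist_eq, Real.dist_eq, abs_lt]
    constructor <;> linarith [hs.1, hs.2, hkt.1, hkt.2]
  have hlt := (pt_lt_pt k.lt_succ_self hk).le
  rw [dist_comm, Real.dist_eq, partialSum_eq_hatSum hπ, h t hkt]
  exact abs_sub_lt_of_affine hkt (key _ ⟨le_rfl, hlt⟩ (pt_mem_points hk.le))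
    (key _ ⟨hlt, le_rfl⟩ (pt_mem_points hk))

/-- A Schauder expansion determines its coefficients. -/
lemma eq_schauderCoeff (hπ : IsFinitelyRefining π) {x : unitInterval → ℝ} {θ : Index π → ℝ}
    (h : ∀ t : unitInterval, Tendsto (fun n => partialSum π x θ n t) atTop (𝓝 (x t))) :
    θ = schauderCoeff π x := by
  funext j
  have key : ∀ s ∈ (π (j.1 + 1)).points,
      Tendsto (fun n => hatSum π x θ n s) atTop (𝓝 (Set.IccExtend zero_le_one x s)) := by
    intro s hs
    have hs' := points_subset hs
    rw [Set.IccExtend_of_mem zero_le_one x hs']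
    simpa only [partialSum_eq_hatSum hπ] using h ⟨s, hs'⟩
  -- Pointwise convergence suffices, since the functional reads three values; on partial sums past
  -- level `j.1` it is constantly `θ j`.
  refine tendsto_nhds_unique (tendsto_const_nhds.congr' ?_) (tendsto_haarCoeff
    (key _ (leftPt_mem hπ j)) (key _ (midPt_mem hπ j)) (key _ (rightPt_mem hπ j)))
  filter_upwards [eventually_gt_atTop j.1] with n hn
  exact (haarCoeff_hatSum hπ x θ j hn).symm

/-- Only increments enter, so the arbitrary `W 0`, perhaps neither Gaussian nor integrable, can be
subtracted. -/
lemma haarCoeff_process_eq {Ω : Type*} (a b c : ℝ) (W : unitInterval → Ω → ℝ)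
    (ω : Ω) :
    haarCoeff a b c (Set.IccExtend zero_le_one fun t => W t ω) =
      √((c - b) / (b - a) * (1 / (c - a))) *
        ((W (Set.projIcc 0 1 zero_le_one b) ω - W 0 ω) -
          (W (Set.projIcc 0 1 zero_le_one a) ω - W 0 ω)) -
      √((b - a) / (c - b) * (1 / (c - a))) *
        ((W (Set.projIcc 0 1 zero_le_one c) ω - W 0 ω) -
          (W (Set.projIcc 0 1 zero_le_one b) ω - W 0 ω)) := by
  simp [haarCoeff, Set.IccExtend]

end Schauder

/-! ### Gaussianity and covariance of Brownian motion started from 0 -/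

namespace IsBrownianMotionOnUnit

variable {Ω : Type*} [MeasurableSpace Ω] {P : Measure Ω} {W : unitInterval → Ω → ℝ}

lemma hasLaw_sub_zero (hW : IsBrownianMotionOnUnit W P) (t : unitInterval) :
    HasLaw (fun ω => W t ω - W 0 ω) (gaussianReal 0 (t : ℝ).toNNReal) P := by
  simpa using hW.law_increment 0 t t.2.1

lemma isGaussianProcess_sub_zero (hW : IsBrownianMotionOnUnit W P) :
    IsGaussianProcess (fun t ω => W t ω - W 0 ω) P := by
  refine HasIndepIncrements.isGaussianProcess (fun t => (hW.hasLaw_sub_zero t).hasGaussianLaw)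
    (.of_forall fun ω => sub_self _) fun n t ht => ?_
  simpa using hW.indepIncrements n t ht

lemma memLp_sub (hW : IsBrownianMotionOnUnit W P) (t : unitInterval) :
    MemLp (fun ω => W t ω - W 0 ω) 2 P :=
  (hW.hasLaw_sub_zero t).hasGaussianLaw.memLp_two

lemma integral_sub_zero (hW : IsBrownianMotionOnUnit W P) (t : unitInterval) :
    ∫ ω, (W t ω - W 0 ω) ∂P = 0 := by
  rw [(hW.hasLaw_sub_zero t).integral_eq, integral_id_gaussianReal]

variable [IsProbabilityMeasure P]

lemma covariance_sub_zero (hW : IsBrownianMotionOnUnit W P) (s t : unitInterval) :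
    cov[fun ω => W s ω - W 0 ω, fun ω => W t ω - W 0 ω; P] = min (s : ℝ) t := by
  wlog hst : s ≤ t generalizing s t
  · rw [covariance_comm, this t s (le_of_not_ge hst), min_comm]
  have h1 := (hW.indepIncrements.indepFun_sub_sub (r := 0) s.2.1 hst).covariance_eq_zero
    (hW.memLp_sub s) (hW.law_increment s t hst).hasGaussianLaw.memLp_two
  have h2 : (fun ω => W t ω - W 0 ω) = (fun ω => W t ω - W s ω) + fun ω => W s ω - W 0 ω := by
    ext; simp
  rw [h2, covariance_add_right (hW.memLp_sub s)
    (hW.law_increment s t hst).hasGaussianLaw.memLp_two (hW.memLp_sub s)]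
  rw [min_eq_left (Subtype.coe_le_coe.2 hst)]
  refine (congrArg₂ (· + ·) h1 ?_).trans (zero_add _)
  rw [covariance_self (hW.memLp_sub s).aemeasurable, (hW.hasLaw_sub_zero s).variance_eq,
    variance_id_gaussianReal, Real.coe_toNNReal _ s.2.1]

end IsBrownianMotionOnUnit

/-! ### Joint law of the Schauder coefficients -/

namespace Schauder

open UnitPartition

variable {π : ℕ → UnitPartition} {Ω : Type*} [MeasurableSpace Ω] {P : Measure Ω}
  {W : unitInterval → Ω → ℝ}

/-- Each coefficient is a fixed linear function of `W - W 0` at three times. -/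
lemma isGaussianProcess_schauderCoeff (hW : IsBrownianMotionOnUnit W P) :
    IsGaussianProcess (fun (j : Index π) ω => schauderCoeff π (fun t => W t ω) j) P := by
  classical
  refine hW.isGaussianProcess_sub_zero.of_isGaussianProcess fun j => ?_
  let p : ℝ → unitInterval := Set.projIcc 0 1 zero_le_one
  let I : Finset unitInterval := {p (leftPt π j), p (midPt π j), p (rightPt π j)}
  let ev (t : I) : (I → ℝ) →L[ℝ] ℝ := ContinuousLinearMap.proj t
  refine ⟨I,
    √((rightPt π j - midPt π j) / (midPt π j - leftPt π j) * (1 / (rightPt π j - leftPt π j))) •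
      (ev ⟨p (midPt π j), by simp [I]⟩ - ev ⟨p (leftPt π j), by simp [I]⟩) -
    √((midPt π j - leftPt π j) / (rightPt π j - midPt π j) * (1 / (rightPt π j - leftPt π j))) •
      (ev ⟨p (rightPt π j), by simp [I]⟩ - ev ⟨p (midPt π j), by simp [I]⟩), fun ω => ?_⟩
  rw [schauderCoeff, haarCoeff_process_eq]
  rfl

variable [IsProbabilityMeasure P]

lemma covariance_haarCoeff_left (hW : IsBrownianMotionOnUnit W P) (a b c : ℝ) {Y : Ω → ℝ}
    (hY : MemLp Y 2 P) :
    cov[fun ω => haarCoeff a b c (Set.IccExtend zero_le_one fun t => W t ω), Y; P] =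
      haarCoeff a b c fun s =>
        cov[fun ω => W (Set.projIcc 0 1 zero_le_one s) ω - W 0 ω, Y; P] := by
  simp only [haarCoeff_process_eq]
  have hm := fun s => hW.memLp_sub (Set.projIcc 0 1 zero_le_one s)
  have hd : ∀ s t, MemLp (fun ω => (W (Set.projIcc 0 1 zero_le_one s) ω - W 0 ω) -
      (W (Set.projIcc 0 1 zero_le_one t) ω - W 0 ω)) 2 P := fun s t => (hm s).sub (hm t)
  rw [covariance_fun_sub_left ((hd b a).const_mul _) ((hd c b).const_mul _) hY,
    covariance_const_mul_left, covariance_const_mul_left,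
    covariance_fun_sub_left (hm b) (hm a) hY, covariance_fun_sub_left (hm c) (hm b) hY]
  rfl

/-- By bilinearity both functionals act on `min s t`: the `j`-th turns it into the `j`-th hat, and
biorthogonality evaluates the `i`-th on that. -/
lemma covariance_schauderCoeff (hW : IsBrownianMotionOnUnit W P) (hπ : IsFinitelyRefining π)
    (i j : Index π) :
    cov[fun ω => schauderCoeff π (fun t => W t ω) i,
      fun ω => schauderCoeff π (fun t => W t ω) j; P] = if i = j then 1 else 0 := by
  have hL := (isGaussianProcess_schauderCoeff (π := π) hW).hasGaussianLaw_eval j |>.memLp_two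
  have hp : ∀ {s : ℝ}, s ∈ Set.Icc (0 : ℝ) 1 →
      (Set.projIcc (0 : ℝ) 1 zero_le_one s : ℝ) = s := fun hs => by
    rw [Set.projIcc_of_mem zero_le_one hs]
  have key : ∀ s ∈ (π (i.1 + 1)).points,
      cov[fun ω => W (Set.projIcc 0 1 zero_le_one s) ω - W 0 ω,
        fun ω => schauderCoeff π (fun t => W t ω) j; P] =
      hat (leftPt π j) (midPt π j) (rightPt π j) s := by
    intro s hs
    have hs' := hp (points_subset hs)
    unfold schauderCoeff
    rw [covariance_comm, covariance_haarCoeff_left hW _ _ _ (hW.memLp_sub _)]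
    simp only [hW.covariance_sub_zero, hs']
    refine haarCoeff_congr ?_ ?_ ?_ <;> rw [min_comm, hp]
    exacts [points_subset (leftPt_mem hπ j), points_subset (midPt_mem hπ j),
      points_subset (rightPt_mem hπ j)]
  rw [← haarCoeff_hat hπ i j]
  conv_lhs => enter [1, ω]; unfold schauderCoeff
  rw [covariance_haarCoeff_left hW _ _ _ hL]
  exact haarCoeff_congr (key _ (leftPt_mem hπ i)) (key _ (midPt_mem hπ i))
    (key _ (rightPt_mem hπ i))

lemma integral_schauderCoeff (hW : IsBrownianMotionOnUnit W P) (j : Index π) :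
    ∫ ω, schauderCoeff π (fun t => W t ω) j ∂P = 0 := by
  have hi := fun s => (hW.memLp_sub (Set.projIcc 0 1 zero_le_one s)).integrable one_le_two
  simp only [schauderCoeff, haarCoeff_process_eq]
  have hd : ∀ s t, Integrable (fun ω => (W (Set.projIcc 0 1 zero_le_one s) ω - W 0 ω) -
      (W (Set.projIcc 0 1 zero_le_one t) ω - W 0 ω)) P := fun s t => (hi s).sub (hi t)
  rw [integral_sub ((hd _ _).const_mul _) ((hd _ _).const_mul _),
    integral_const_mul, integral_const_mul, integral_sub (hi _) (hi _),
    integral_sub (hi _) (hi _)]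
  simp [hW.integral_sub_zero]

lemma hasLaw_schauderCoeff (hW : IsBrownianMotionOnUnit W P) (hπ : IsFinitelyRefining π)
    (j : Index π) :
    HasLaw (fun ω => schauderCoeff π (fun t => W t ω) j) (gaussianReal 0 1) P := by
  have hG := (isGaussianProcess_schauderCoeff (π := π) hW).hasGaussianLaw_eval j
  refine ⟨hG.aemeasurable, ?_⟩
  rw [hG.map_eq_gaussianReal, integral_schauderCoeff hW, ← covariance_self hG.aemeasurable,
    covariance_schauderCoeff hW hπ, if_pos rfl, Real.toNNReal_one]

/-- Independence is a matter of finite subfamilies, where jointly Gaussian and uncorrelated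
variables are independent. -/
lemma iIndepFun_schauderCoeff (hW : IsBrownianMotionOnUnit W P) (hπ : IsFinitelyRefining π) :
    iIndepFun (fun (j : Index π) ω => schauderCoeff π (fun t => W t ω) j) P := by
  refine iIndepFun_iff_finset.2 fun s => ?_
  refine ((isGaussianProcess_schauderCoeff hW).hasGaussianLaw s).iIndepFun_of_covariance_eq_zero
    fun i j hij => ?_
  exact (covariance_schauderCoeff hW hπ i j).trans (if_neg fun h => hij (Subtype.ext h))

end Schauder

theorem mainTheorem10 {Ω : Type*} [MeasurableSpace Ω] (P : Measure Ω) [IsProbabilityMeasure P]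
    (W : unitInterval → Ω → ℝ) (hW : IsBrownianMotionOnUnit W P)
    (π : ℕ → UnitPartition) (hπ : IsFinitelyRefining π) (hπ0 : (π 0).points = {0, 1}) :
    ∃ η : Schauder.Index π → Ω → ℝ,
      (∀ᵐ ω ∂P,
        TendstoUniformly (Schauder.partialSum π (fun t => W t ω) (fun j => η j ω))
          (fun t => W t ω) atTop ∧
        ∀ θ : Schauder.Index π → ℝ,
          (∀ t : unitInterval,
            Tendsto (fun n => Schauder.partialSum π (fun t => W t ω) θ n t) atTop (𝓝 (W t ω))) →
          θ = fun j => η j ω) ∧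
      iIndepFun η P ∧
      ∀ j, HasLaw (η j) (gaussianReal 0 1) P := by
  refine ⟨fun j ω => Schauder.schauderCoeff π (fun t => W t ω) j, ?_,
    Schauder.iIndepFun_schauderCoeff hW hπ, Schauder.hasLaw_schauderCoeff hW hπ⟩
  filter_upwards [hW.continuous_paths] with ω hω
  exact ⟨Schauder.tendstoUniformly_partialSum hπ hπ0 hω, fun θ h => Schauder.eq_schauderCoeff hπ h⟩
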